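/- A plane $c$-tree is a (not necessarily finite, not necessarily locally finite) rooted tree together with a linear order on the set of children of each node and with an interpretation of some, possibly none or all, of the countably many constants $c_1,c_2,\ldots$ by pairwise different nodes. It is viewed as a structure with the binary relations $\mathbf{parnt}(x,y)$ ($x$ is a child of $y$) and $\mathbf{succ}(x,y)$ ($x$ and $y$ are children of the same node and $y$ immediately follows $x$ in the order of the children of this node) and with the constants; an atomic formula containing a constant that is not interpreted is considered to be false. A $d$-formula is a first order formula in this signature with quantifier depth at most $d$ that contains no constants except for $c_1,\ldots,c_d$, and a $d$-sentence is a $d$-formula without free variables. A formula is local if each of its quantifiers is of the form $\forall_z x$ or $\exists_z x$, where $x$ ranges over the neighbors (the parent and the children) of the vertex $z$. The $d$-Hintikka type of a node $v$ of a plane $c$-tree $T$ is the set of all local $d$-formulas $\psi$ with one free variable such that $T\models\psi(v)$. **Theorem.** For every non-negative integer $d$, there exist non-negative integers $D$ and $\Gamma$ such that the following holds for any two (not necessarily finite) plane $c$-trees $T$ and $T'$. If for each $D$-Hintikka type, either the numbers of nodes of this type in $T$ and in $T'$ are the same, or the number of nodes of this type is at least $\Gamma$ in both $T$ and $T'$,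 then the sets of $d$-sentences satisfied by $T$ and by $T'$ are the same. -/

import Mathlib

universe u v

/-- A plane `c`-tree, possibly infinite and with unbounded degrees: a rooted tree (the order of
`tree` is the ancestor order, so its least element is the root and `y ⋖ x` says that `y` is the
parent of `x`), a linear order from left to right on the children of each node, and countably many
constants, each of which may or may not be interpreted; different interpreted constants are
interpreted by different nodes. -/
structure PlaneCTree where
  /-- the underlying rooted tree -/
  tree : RootedTree.{u}
  /-- `leftOf x y`: the node `x` is to the left of its sibling `y`
  (only the restriction of this relation to pairs of siblings is ever used) -/
  leftOf : tree → tree → Prop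
  /-- the children of each node are linearly ordered -/
  leftOf_strictTotalOrder : ∀ z : tree,
    IsStrictTotalOrder {x : tree // z ⋖ x} (fun x y => leftOf x.1 y.1)
  /-- `const i` is the node that interprets the `i`-th constant, `none` if it is not interpreted -/
  const : ℕ → Option tree
  /-- the interpreted constants are pairwise different -/
  const_injective : ∀ (i j : ℕ) (x : tree), const i = some x → const j = some x → i = j

namespace PlaneCTree

/-- `Parnt x y`: the node `x` is a child of the node `y`. -/
def Parnt (T : PlaneCTree.{u}) (x y : T.tree) : Prop := y ⋖ x

/-- `Succ x y`: the nodes `x` and `y` are children of the same node and `y` comes immediately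
after `x` in the order of the children of this node. -/
def Succ (T : PlaneCTree.{u}) (x y : T.tree) : Prop :=
  ∃ z : T.tree, T.Parnt x z ∧ T.Parnt y z ∧ T.leftOf x y ∧
    ∀ w : T.tree, T.Parnt w z → ¬ (T.leftOf x w ∧ T.leftOf w y)

/-- Terms with `n` free variables in the signature of plane `c`-trees. -/
inductive Term (n : ℕ) : Type
  | var (i : Fin n) : Term n
  | const (i : ℕ) : Term n

/-- First order formulas with `n` free variables in the signature of plane `c`-trees. In `all φ`
the bound variable is the last one of `φ`. -/
inductive Formula : ℕ → Type
  | falsum {n : ℕ} : Formula n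
  | eq {n : ℕ} (s t : Term n) : Formula n
  | parnt {n : ℕ} (s t : Term n) : Formula n
  | succ {n : ℕ} (s t : Term n) : Formula n
  | imp {n : ℕ} (φ ψ : Formula n) : Formula n
  | all {n : ℕ} (φ : Formula (n + 1)) : Formula n

/-- The node denoted by a term, if any (there is none if the term is an uninterpreted constant). -/
def Term.eval (T : PlaneCTree.{u}) {n : ℕ} (a : Fin n → T.tree) : Term n → Option T.tree
  | .var i => some (a i)
  | .const i => T.const i

namespace Formula

/-- Negation. -/
def neg {n : ℕ} (φ : Formula n) : Formula n := imp φ falsum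

/-- Disjunction. -/
def disj {n : ℕ} (φ ψ : Formula n) : Formula n := imp (neg φ) ψ

/-- `s` and `t` are neighbors in the tree, i.e. one of them is the parent of the other one. -/
def adj {n : ℕ} (s t : Term n) : Formula n := disj (parnt s t) (parnt t s)

/-- The quantifier `∀_z x` over all neighbors `x` of the vertex `z`; the dual quantifier `∃_z x`
is `¬ ∀_z x ¬`. -/
def allNbr {n : ℕ} (z : Fin n) (φ : Formula (n + 1)) : Formula n :=
  all (imp (adj (.var (Fin.last n)) (.var z.castSucc)) φ)

/-- Satisfaction of a formula in a plane `c`-tree. An atomic formula that contains an uninterpreted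
constant is not satisfied. -/
def Realize (T : PlaneCTree.{u}) : {n : ℕ} → Formula n → (Fin n → T.tree) → Prop
  | _, .falsum, _ => False
  | _, .eq s t, a => ∃ x, s.eval T a = some x ∧ t.eval T a = some x
  | _, .parnt s t, a => ∃ x y, s.eval T a = some x ∧ t.eval T a = some y ∧ T.Parnt x y
  | _, .succ s t, a => ∃ x y, s.eval T a = some x ∧ t.eval T a = some y ∧ T.Succ x y
  | _, .imp φ ψ, a => Realize T φ a → Realize T ψ a
  | _, .all φ, a => ∀ x : T.tree, Realize T φ (Fin.snoc a x)

/-- The quantifier depth of a formula. -/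
def depth : {n : ℕ} → Formula n → ℕ
  | _, .falsum => 0
  | _, .eq _ _ => 0
  | _, .parnt _ _ => 0
  | _, .succ _ _ => 0
  | _, .imp φ ψ => max φ.depth ψ.depth
  | _, .all φ => φ.depth + 1

end Formula

/-- The term is not a constant other than the first `d` constants. -/
def Term.ConstsBelow (d : ℕ) {n : ℕ} : Term n → Prop
  | .var _ => True
  | .const i => i < d

namespace Formula

/-- The formula contains no constants except for the first `d` constants. -/
def ConstsBelow (d : ℕ) : {n : ℕ} → Formula n → Prop
  | _, .falsum => True
  | _, .eq s t => s.ConstsBelow d ∧ t.ConstsBelow d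
  | _, .parnt s t => s.ConstsBelow d ∧ t.ConstsBelow d
  | _, .succ s t => s.ConstsBelow d ∧ t.ConstsBelow d
  | _, .imp φ ψ => ConstsBelow d φ ∧ ConstsBelow d ψ
  | _, .all φ => ConstsBelow d φ

/-- A `d`-formula: its quantifier depth is at most `d` and it contains no constants except for
the first `d` constants. -/
def IsDFormula (d : ℕ) {n : ℕ} (φ : Formula n) : Prop := φ.depth ≤ d ∧ φ.ConstsBelow d

/-- Local formulas: every quantifier is restricted to the neighbors of a vertex. -/
inductive IsLocal : {n : ℕ} → Formula n → Prop
  | falsum {n : ℕ} : IsLocal (Formula.falsum : Formula n)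
  | eq {n : ℕ} (s t : Term n) : IsLocal (Formula.eq s t)
  | parnt {n : ℕ} (s t : Term n) : IsLocal (Formula.parnt s t)
  | succ {n : ℕ} (s t : Term n) : IsLocal (Formula.succ s t)
  | imp {n : ℕ} {φ ψ : Formula n} : IsLocal φ → IsLocal ψ → IsLocal (Formula.imp φ ψ)
  | allNbr {n : ℕ} (z : Fin n) {φ : Formula (n + 1)} : IsLocal φ → IsLocal (Formula.allNbr z φ)

end Formula

/-- The `d`-Hintikka type of a node: the set of all local `d`-formulas with one free variable that
the node satisfies. -/
def hintikkaType (T : PlaneCTree.{u}) (d : ℕ) (x : T.tree) : Set (Formula 1) :=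
  {φ | φ.IsLocal ∧ φ.IsDFormula d ∧ φ.Realize T (fun _ => x)}

/-- The number (possibly infinite) of nodes whose `d`-Hintikka type is `τ`. -/
noncomputable def typeCount (T : PlaneCTree.{u}) (d : ℕ) (τ : Set (Formula 1)) : ℕ∞ :=
  {x : T.tree | T.hintikkaType d x = τ}.encard

/-- The set of all `d`-sentences satisfied by a plane `c`-tree. -/
def dTheory (T : PlaneCTree.{u}) (d : ℕ) : Set (Formula 0) :=
  {φ | φ.IsDFormula d ∧ φ.Realize T Fin.elim0}

end PlaneCTree

/-!
Two Ehrenfeucht-Fraïssé games on a pair of plane `c`-trees are compared. In the local game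
(`LocalEquiv`), Spoiler may only choose neighbors of nodes chosen before; it characterizes equality
of local types (`localType_eq_iff`, which rests on the fact that there are finitely many local
formulas of bounded depth up to equivalence). In the global game (`GlobalEquiv`), which
characterizes the sentences, every node may be chosen. The theorem follows once Duplicator can
answer each global move in such a way that the position stays won in a shorter local game
(`exists_localEquiv_insert`).

A global move to a node `x` near the nodes chosen before can be simulated by local moves: up to a
common ancestor and down again. If `x` is far from all these nodes, it suffices to find a node `y`
of the same local type as `x` that is far from the chosen nodes of the other tree, since far apart
parts of a position can be played independently of each other (`LocalEquiv.union`).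

That `y` exists (`exists_far_localEquiv`) is where the tree structure and the numbers of nodes
enter. In a graph this may fail, as there can be many nodes of a type all of which are close to a
single node. In a tree, however, all nodes at distance at most `r` from a node `b` have their `r`-th
ancestors among the first `2r` ancestors of `b`. So if all candidates for `y` were close to chosen
nodes, then there would be few nodes with the local type of the `r`-th ancestor `w` of `x`, all of
them being ancestors of chosen nodes. Their number would be the same in both trees. But the
corresponding ancestors of the chosen nodes in the tree of `x` already have this type, and `w` is a
further node of this type as `x` is far from the chosen nodes.
-/

namespace PlaneCTree

open Order

/-! ### Ancestors and nearness -/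

section Tree

variable (T : PlaneCTree.{u})

/-- `x` and `y` are neighbors in the tree: one of them is the parent of the other one. -/
def Adj (x y : T.tree) : Prop := T.Parnt x y ∨ T.Parnt y x

/-- `x` and `y` have a common ancestor at most `r` levels above each of them. Here the parent of
a node `x` is `Order.pred x`, and the root is its own predecessor. -/
def Near (r : ℕ) (x y : T.tree) : Prop := ∃ p ≤ r, ∃ q ≤ r, pred^[p] x = pred^[q] y

variable {T}

theorem parnt_iff {x y : T.tree} : T.Parnt x y ↔ x ≠ ⊥ ∧ pred x = y := by
  constructor
  · intro h
    exact ⟨fun hx => by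
      have := h.lt
      rw [hx] at this
      exact not_lt_bot this, pred_eq_of_covBy h⟩
  · rintro ⟨h, rfl⟩
    exact pred_covBy_of_not_isMin (by rwa [isMin_iff_eq_bot])

theorem Near.symm {r : ℕ} {x y : T.tree} (h : T.Near r x y) : T.Near r y x := by
  obtain ⟨p, hp, q, hq, h⟩ := h
  exact ⟨q, hq, p, hp, h.symm⟩

theorem Near.mono {r s : ℕ} {x y : T.tree} (h : T.Near r x y) (hrs : r ≤ s) : T.Near s x y := by
  obtain ⟨p, hp, q, hq, h⟩ := h
  exact ⟨p, hp.trans hrs, q, hq.trans hrs, h⟩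

theorem Near.of_adj {r : ℕ} {u x y : T.tree} (h : T.Near r u y) (hu : T.Adj u x) :
    T.Near (r + 1) x y := by
  obtain ⟨p, hp, q, hq, h⟩ := h
  rcases hu with hu | hu
  · obtain ⟨-, rfl⟩ := parnt_iff.1 hu
    refine ⟨p, by omega, q + 1, by omega, ?_⟩
    rw [← Function.iterate_succ_apply, Function.iterate_succ_apply', h,
      Function.iterate_succ_apply']
  · obtain ⟨-, rfl⟩ := parnt_iff.1 hu
    exact ⟨p + 1, by omega, q, by omega, h⟩

theorem near_one_of_parnt {x y : T.tree} (h : T.Parnt x y) : T.Near 1 x y :=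
  ⟨1, le_rfl, 0, zero_le_one, (parnt_iff.1 h).2⟩

theorem near_one_of_succ {x y : T.tree} (h : T.Succ x y) : T.Near 1 x y := by
  obtain ⟨z, hx, hy, -⟩ := h
  exact ⟨1, le_rfl, 1, le_rfl, (parnt_iff.1 hx).2.trans (parnt_iff.1 hy).2.symm⟩

theorem Near.exists_iterate_pred_eq {r : ℕ} {x y : T.tree} (h : T.Near r x y) :
    ∃ l ≤ 2 * r, pred^[r] x = pred^[l] y := by
  obtain ⟨p, hp, q, hq, h⟩ := h
  refine ⟨(r - p) + q, by omega, ?_⟩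
  rw [Function.iterate_add_apply, ← h, ← Function.iterate_add_apply, Nat.sub_add_cancel hp]

end Tree

/-! ### Ehrenfeucht-Fraïssé games -/

section Game

variable {T : PlaneCTree.{u}} {T' : PlaneCTree.{v}} {d m : ℕ} {P Q : Set (T.tree × T'.tree)}

/-- The pairs of nodes that interpret the same constant among the first `d` ones. -/
def constPairs (T : PlaneCTree.{u}) (T' : PlaneCTree.{v}) (d : ℕ) : Set (T.tree × T'.tree) :=
  {p | ∃ i < d, T.const i = some p.1 ∧ T'.const i = some p.2}

/-- The correspondences `p` and `q` between nodes of `T` and `T'` agree on the atomic relations. -/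
def SameAtoms (p q : T.tree × T'.tree) : Prop :=
  (p.1 = q.1 ↔ p.2 = q.2) ∧ (T.Parnt p.1 q.1 ↔ T'.Parnt p.2 q.2) ∧
    (T.Succ p.1 q.1 ↔ T'.Succ p.2 q.2)

/-- The set `P` of pairs of nodes is a partial isomorphism in the signature with the first `d`
constants. -/
def IsPartialIso (d : ℕ) (P : Set (T.tree × T'.tree)) : Prop :=
  (∀ i < d, (T.const i).isSome ↔ (T'.const i).isSome) ∧
    ∀ p ∈ P ∪ constPairs T T' d, ∀ q ∈ P ∪ constPairs T T' d, SameAtoms p q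

/-- Duplicator wins the local Ehrenfeucht-Fraïssé game with `m` rounds from the position `P`, in
which each move of Spoiler chooses a neighbor of a node that has already been chosen. A position
is the set of the pairs of corresponding nodes, so that the order of the moves is forgotten. -/
def LocalEquiv (d : ℕ) : ℕ → Set (T.tree × T'.tree) → Prop
  | 0, P => IsPartialIso d P
  | m + 1, P => IsPartialIso d P ∧ ∀ p ∈ P,
      (∀ x, T.Adj x p.1 → ∃ y, T'.Adj y p.2 ∧ LocalEquiv d m (insert (x, y) P)) ∧
      (∀ y, T'.Adj y p.2 → ∃ x, T.Adj x p.1 ∧ LocalEquiv d m (insert (x, y) P))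

/-- Duplicator wins the unrestricted Ehrenfeucht-Fraïssé game with `m` rounds from the
position `P`. -/
def GlobalEquiv (d : ℕ) : ℕ → Set (T.tree × T'.tree) → Prop
  | 0, P => IsPartialIso d P
  | m + 1, P => IsPartialIso d P ∧
      (∀ x, ∃ y, GlobalEquiv d m (insert (x, y) P)) ∧
      (∀ y, ∃ x, GlobalEquiv d m (insert (x, y) P))

theorem IsPartialIso.mono (h : IsPartialIso d P) (hQ : Q ⊆ P) : IsPartialIso d Q :=
  ⟨h.1, fun p hp q hq => h.2 p (Set.union_subset_union_left _ hQ hp) q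
    (Set.union_subset_union_left _ hQ hq)⟩

theorem IsPartialIso.swap (h : IsPartialIso d P) : IsPartialIso d (Prod.swap ⁻¹' P) := by
  have key : ∀ p : T'.tree × T.tree, p ∈ Prod.swap ⁻¹' P ∪ constPairs T' T d →
      p.swap ∈ P ∪ constPairs T T' d := by
    rintro p (hp | ⟨i, hi, h1, h2⟩)
    · exact Or.inl hp
    · exact Or.inr ⟨i, hi, h2, h1⟩
  refine ⟨fun i hi => (h.1 i hi).symm, fun p hp q hq => ?_⟩
  obtain ⟨h1, h2, h3⟩ := h.2 _ (key p hp) _ (key q hq)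
  exact ⟨h1.symm, h2.symm, h3.symm⟩

theorem LocalEquiv.isPartialIso (h : LocalEquiv d m P) : IsPartialIso d P := by
  cases m with
  | zero => exact h
  | succ m => exact h.1

theorem GlobalEquiv.isPartialIso (h : GlobalEquiv d m P) : IsPartialIso d P := by
  cases m with
  | zero => exact h
  | succ m => exact h.1

theorem LocalEquiv.mono (h : LocalEquiv d m P) (hQ : Q ⊆ P) : LocalEquiv d m Q := by
  induction m generalizing P Q with
  | zero => exact IsPartialIso.mono h hQ
  | succ m ih =>
    refine ⟨h.1.mono hQ, fun p hp => ⟨fun x hx => ?_, fun y hy => ?_⟩⟩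
    · obtain ⟨y, hy, hxy⟩ := (h.2 p (hQ hp)).1 x hx
      exact ⟨y, hy, ih hxy (Set.insert_subset_insert hQ)⟩
    · obtain ⟨x, hx, hxy⟩ := (h.2 p (hQ hp)).2 y hy
      exact ⟨x, hx, ih hxy (Set.insert_subset_insert hQ)⟩

theorem LocalEquiv.of_succ (h : LocalEquiv d (m + 1) P) : LocalEquiv d m P := by
  induction m generalizing P with
  | zero => exact h.1
  | succ m ih =>
    refine ⟨h.1, fun p hp => ⟨fun x hx => ?_, fun y hy => ?_⟩⟩
    · obtain ⟨y, hy, hxy⟩ := (h.2 p hp).1 x hx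
      exact ⟨y, hy, ih hxy⟩
    · obtain ⟨x, hx, hxy⟩ := (h.2 p hp).2 y hy
      exact ⟨x, hx, ih hxy⟩

theorem LocalEquiv.of_le {k : ℕ} (h : LocalEquiv d m P) (hk : k ≤ m) : LocalEquiv d k P := by
  induction hk with
  | refl => exact h
  | step _ ih => exact ih h.of_succ

theorem LocalEquiv.swap (h : LocalEquiv d m P) : LocalEquiv d m (Prod.swap ⁻¹' P) := by
  induction m generalizing P with
  | zero => exact IsPartialIso.swap h
  | succ m ih =>
    have key : ∀ (x : T.tree) (y : T'.tree), Prod.swap ⁻¹' (insert (x, y) P) = insert (y, x) (Prod.swap ⁻¹' P) := by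
      intro x y
      ext ⟨y', x'⟩
      simp [and_comm]
    refine ⟨h.1.swap, fun p hp => ⟨fun y hy => ?_, fun x hx => ?_⟩⟩
    · obtain ⟨x, hx, hxy⟩ := (h.2 _ hp).2 y hy
      exact ⟨x, hx, key x y ▸ ih hxy⟩
    · obtain ⟨y, hy, hxy⟩ := (h.2 _ hp).1 x hx
      exact ⟨y, hy, key x y ▸ ih hxy⟩

theorem SameAtoms.of_not_near {p q : T.tree × T'.tree} (h : ¬ T.Near 1 p.1 q.1)
    (h' : ¬ T'.Near 1 p.2 q.2) : SameAtoms p q :=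
  ⟨iff_of_false (fun e => h ⟨0, zero_le_one, 0, zero_le_one, e⟩)
      (fun e => h' ⟨0, zero_le_one, 0, zero_le_one, e⟩),
    iff_of_false (fun e => h (near_one_of_parnt e)) (fun e => h' (near_one_of_parnt e)),
    iff_of_false (fun e => h (near_one_of_succ e)) (fun e => h' (near_one_of_succ e))⟩

theorem IsPartialIso.union (hP : IsPartialIso d P) (hQ : IsPartialIso d Q)
    (h : ∀ p ∈ P, ∀ q ∈ Q, ¬ T.Near 1 p.1 q.1 ∧ ¬ T'.Near 1 p.2 q.2) :
    IsPartialIso d (P ∪ Q) := by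
  refine ⟨hP.1, ?_⟩
  rintro p ((hp | hp) | hp) q ((hq | hq) | hq)
  · exact hP.2 p (.inl hp) q (.inl hq)
  · exact .of_not_near (h p hp q hq).1 (h p hp q hq).2
  · exact hP.2 p (.inl hp) q (.inr hq)
  · exact .of_not_near (fun e => (h q hq p hp).1 e.symm) (fun e => (h q hq p hp).2 e.symm)
  · exact hQ.2 p (.inl hp) q (.inl hq)
  · exact hQ.2 p (.inl hp) q (.inr hq)
  · exact hP.2 p (.inr hp) q (.inl hq)
  · exact hQ.2 p (.inr hp) q (.inl hq)
  · exact hP.2 p (.inr hp) q (.inr hq)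

/-- Two positions whose nodes are far apart from each other can be played independently: a move
in one of them brings its nodes at most one step closer to those of the other one. -/
theorem LocalEquiv.union (hP : LocalEquiv d m P) (hQ : LocalEquiv d m Q)
    (h : ∀ p ∈ P, ∀ q ∈ Q, ¬ T.Near (m + 1) p.1 q.1 ∧ ¬ T'.Near (m + 1) p.2 q.2) :
    LocalEquiv d m (P ∪ Q) := by
  induction m generalizing P Q with
  | zero => exact IsPartialIso.union hP hQ h
  | succ m ih =>
    have near : ∀ p ∈ P, ∀ q ∈ Q, ¬ T.Near 1 p.1 q.1 ∧ ¬ T'.Near 1 p.2 q.2 :=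
      fun p hp q hq => ⟨fun e => (h p hp q hq).1 (e.mono (by omega)),
        fun e => (h p hp q hq).2 (e.mono (by omega))⟩
    have move : ∀ {P Q : Set (T.tree × T'.tree)},
        LocalEquiv d (m + 1) Q →
        (∀ p ∈ P, ∀ q ∈ Q, ¬ T.Near (m + 2) p.1 q.1 ∧ ¬ T'.Near (m + 2) p.2 q.2) →
        ∀ p ∈ P, ∀ x y, T.Adj x p.1 → T'.Adj y p.2 → LocalEquiv d m (insert (x, y) P) →
          LocalEquiv d m (insert (x, y) (P ∪ Q)) := by
      intro P Q hQ h p hp x y hx hy hxy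
      rw [← Set.insert_union]
      refine ih hxy hQ.of_succ ?_
      rintro p' (rfl | hp') q hq
      · exact ⟨fun e => (h p hp q hq).1 (e.of_adj hx), fun e => (h p hp q hq).2 (e.of_adj hy)⟩
      · exact ⟨fun e => (h p' hp' q hq).1 (e.mono (by omega)),
          fun e => (h p' hp' q hq).2 (e.mono (by omega))⟩
    have h' : ∀ q ∈ Q, ∀ p ∈ P, ¬ T.Near (m + 2) q.1 p.1 ∧ ¬ T'.Near (m + 2) q.2 p.2 :=
      fun q hq p hp => ⟨fun e => (h p hp q hq).1 e.symm, fun e => (h p hp q hq).2 e.symm⟩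
    refine ⟨hP.1.union hQ.1 near, ?_⟩
    rintro p (hp | hp)
    · refine ⟨fun x hx => ?_, fun y hy => ?_⟩
      · obtain ⟨y, hy, hxy⟩ := (hP.2 p hp).1 x hx
        exact ⟨y, hy, move hQ h p hp x y hx hy hxy⟩
      · obtain ⟨x, hx, hxy⟩ := (hP.2 p hp).2 y hy
        exact ⟨x, hx, move hQ h p hp x y hx hy hxy⟩
    · rw [Set.union_comm]
      refine ⟨fun x hx => ?_, fun y hy => ?_⟩
      · obtain ⟨y, hy, hxy⟩ := (hQ.2 p hp).1 x hx
        exact ⟨y, hy, move hP h' p hp x y hx hy hxy⟩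
      · obtain ⟨x, hx, hxy⟩ := (hQ.2 p hp).2 y hy
        exact ⟨x, hx, move hP h' p hp x y hx hy hxy⟩

/-- Duplicator answers the move to a parent by the parent. At the root, where `pred` is the
identity, there is nothing to answer. -/
theorem LocalEquiv.insert_pred (h : LocalEquiv d (m + 1) P) {a : T.tree} {b : T'.tree}
    (hab : (a, b) ∈ P) : LocalEquiv d m (insert (pred a, pred b) P) := by
  by_cases ha : a = ⊥
  · have hb : b = ⊥ := by
      by_contra hb
      obtain ⟨x, -, hxy⟩ := (h.2 _ hab).2 (pred b) (.inr (parnt_iff.2 ⟨hb, rfl⟩))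
      exact (parnt_iff.1 (((hxy.isPartialIso.2 (a, b) (.inl (.inr hab)) (x, pred b)
        (.inl (.inl rfl))).2.1).2 (parnt_iff.2 ⟨hb, rfl⟩))).1 ha
    have : (pred a, pred b) ∈ P := by rwa [ha, hb, pred_bot, pred_bot, ← ha, ← hb]
    rw [Set.insert_eq_of_mem this]
    exact h.of_succ
  · have hpa : T.Parnt a (pred a) := parnt_iff.2 ⟨ha, rfl⟩
    obtain ⟨y, -, hxy⟩ := (h.2 _ hab).1 (pred a) (.inr hpa)
    have := ((hxy.isPartialIso.2 (a, b) (.inl (.inr hab)) (pred a, y) (.inl (.inl rfl))).2.1).1 hpa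
    rwa [(parnt_iff.1 this).2]

theorem LocalEquiv.insert_iterate_pred {s : ℕ} (h : LocalEquiv d (m + s) P) {a : T.tree}
    {b : T'.tree} (hab : (a, b) ∈ P) : LocalEquiv d m (insert (pred^[s] a, pred^[s] b) P) := by
  induction s generalizing a b P with
  | zero => rwa [Function.iterate_zero_apply, Function.iterate_zero_apply,
      Set.insert_eq_of_mem hab]
  | succ s ih =>
    exact (ih (LocalEquiv.insert_pred h hab) (Set.mem_insert _ _)).mono
      (Set.insert_subset_insert (Set.subset_insert _ _))

/-- Moves from the `s`-th ancestor of `x` down to `x` can be answered. If `x` has fewer than `s`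
proper ancestors, then `pred^[s] x` and its counterpart are the roots. -/
theorem LocalEquiv.exists_iterate_pred_eq {s : ℕ} (h : LocalEquiv d (m + s) P) {x : T.tree}
    {w : T'.tree} (hw : (pred^[s] x, w) ∈ P) :
    ∃ y, pred^[s] y = w ∧ LocalEquiv d m (insert (x, y) P) := by
  induction s generalizing w P with
  | zero =>
    rw [Function.iterate_zero_apply] at hw
    exact ⟨w, rfl, by rwa [Set.insert_eq_of_mem hw]⟩
  | succ s ih =>
    rw [Function.iterate_succ_apply'] at hw
    -- it suffices to answer the step from `pred (pred^[s] x)` to `pred^[s] x`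
    have key : ∃ u, pred u = w ∧ LocalEquiv d (m + s) (insert (pred^[s] x, u) P) := by
      by_cases hu : pred^[s] x = ⊥
      · rw [hu, pred_bot] at hw
        have hw' : w = ⊥ := by
          have := (LocalEquiv.insert_pred h hw).isPartialIso
          have := (this.2 (⊥, w) (.inl (.inr hw)) (pred ⊥, pred w) (.inl (.inl rfl))).1.1
            pred_bot.symm
          by_contra hne
          exact hne ((pred_eq_iff_isMin.1 this.symm).eq_bot)
        refine ⟨w, by rw [hw', pred_bot], ?_⟩
        rw [hu, Set.insert_eq_of_mem hw]
        exact LocalEquiv.of_succ h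
      · have hpu : T.Parnt (pred^[s] x) (pred (pred^[s] x)) := parnt_iff.2 ⟨hu, rfl⟩
        obtain ⟨u, -, hxu⟩ := (h.2 _ hw).1 (pred^[s] x) (.inl hpu)
        exact ⟨u, (parnt_iff.1 (((hxu.isPartialIso.2 (_, u) (.inl (.inl rfl)) (_, w)
          (.inl (.inr hw))).2.1).1 hpu)).2, hxu⟩
    obtain ⟨u, hu, hxu⟩ := key
    obtain ⟨y, hy, hxy⟩ := ih hxu (Set.mem_insert _ _)
    refine ⟨y, by rw [Function.iterate_succ_apply', hy, hu], hxy.mono ?_⟩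
    exact Set.insert_subset_insert (Set.subset_insert _ _)

end Game

/-! ### Games and formulas -/

section Formulas

variable {T : PlaneCTree.{u}} {T' : PlaneCTree.{v}} {d m n : ℕ}

/-- The position in which the nodes `a i` and `b i` correspond to each other. -/
def pairs (a : Fin n → T.tree) (b : Fin n → T'.tree) : Set (T.tree × T'.tree) :=
  Set.range fun i => (a i, b i)

theorem pairs_snoc (a : Fin n → T.tree) (b : Fin n → T'.tree) (x : T.tree) (y : T'.tree) :
    pairs (Fin.snoc (α := fun _ => T.tree) a x) (Fin.snoc (α := fun _ => T'.tree) b y) =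
      insert (x, y) (pairs a b) := by
  ext p
  constructor
  · rintro ⟨i, rfl⟩
    refine Fin.lastCases ?_ (fun i => ?_) i
    · left; simp
    · right; exact ⟨i, by simp⟩
  · rintro (rfl | ⟨i, rfl⟩)
    · exact ⟨Fin.last n, by simp⟩
    · exact ⟨i.castSucc, by simp⟩

theorem mem_pairs_union_constPairs {a : Fin n → T.tree} {b : Fin n → T'.tree}
    {p : T.tree × T'.tree} : p ∈ pairs a b ∪ constPairs T T' d ↔
      ∃ s : Term n, s.ConstsBelow d ∧ s.eval T a = some p.1 ∧ s.eval T' b = some p.2 := by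
  constructor
  · rintro (⟨i, rfl⟩ | ⟨i, hi, h⟩)
    · exact ⟨.var i, trivial, rfl, rfl⟩
    · exact ⟨.const i, hi, h⟩
  · rintro ⟨i | i, hs, h1, h2⟩
    · exact .inl ⟨i, Prod.ext (Option.some.inj h1) (Option.some.inj h2)⟩
    · exact .inr ⟨i, hs, h1, h2⟩

/-- In a partial isomorphism, a term denotes a node in one tree iff it does in the other one. -/
theorem IsPartialIso.eval {a : Fin n → T.tree} {b : Fin n → T'.tree}
    (h : IsPartialIso d (pairs a b)) {s : Term n} (hs : s.ConstsBelow d) :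
    (s.eval T a = none ∧ s.eval T' b = none) ∨ ∃ p ∈ pairs a b ∪ constPairs T T' d,
      s.eval T a = some p.1 ∧ s.eval T' b = some p.2 := by
  have hsome : (s.eval T a).isSome ↔ (s.eval T' b).isSome := by
    cases s with
    | var i => simp [Term.eval]
    | const i => exact h.1 i hs
  cases h1 : s.eval T a with
  | none => simpa [h1] using hsome
  | some x =>
    obtain ⟨y, h2⟩ := Option.isSome_iff_exists.1 (hsome.1 (by simp [h1]))
    exact .inr ⟨(x, y), mem_pairs_union_constPairs.2 ⟨s, hs, h1, h2⟩, rfl, h2⟩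

theorem IsPartialIso.realize_atom_iff {a : Fin n → T.tree} {b : Fin n → T'.tree}
    (h : IsPartialIso d (pairs a b)) {s t : Term n} (hs : s.ConstsBelow d)
    (ht : t.ConstsBelow d) :
    ((Formula.eq s t).Realize T a ↔ (Formula.eq s t).Realize T' b) ∧
    ((Formula.parnt s t).Realize T a ↔ (Formula.parnt s t).Realize T' b) ∧
    ((Formula.succ s t).Realize T a ↔ (Formula.succ s t).Realize T' b) := by
  rcases h.eval hs with ⟨h1, h2⟩ | ⟨p, hp, h1, h2⟩
  · simp [Formula.Realize, h1, h2]
  rcases h.eval ht with ⟨h3, h4⟩ | ⟨q, hq, h3, h4⟩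
  · simp [Formula.Realize, h3, h4]
  obtain ⟨e1, e2, e3⟩ := h.2 p hp q hq
  simp only [Formula.Realize, h1, h2, h3, h4, Option.some.injEq]
  refine ⟨?_, by simpa using e2, by simpa using e3⟩
  simpa [eq_comm] using e1

theorem GlobalEquiv.realize_iff {φ : Formula n} (hφ : φ.depth ≤ m) (hc : φ.ConstsBelow d)
    {a : Fin n → T.tree} {b : Fin n → T'.tree} (h : GlobalEquiv d m (pairs a b)) :
    φ.Realize T a ↔ φ.Realize T' b := by
  induction φ generalizing m with
  | falsum => exact Iff.rfl
  | eq s t => exact (h.isPartialIso.realize_atom_iff hc.1 hc.2).1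
  | parnt s t => exact (h.isPartialIso.realize_atom_iff hc.1 hc.2).2.1
  | succ s t => exact (h.isPartialIso.realize_atom_iff hc.1 hc.2).2.2
  | imp φ ψ ih1 ih2 =>
    exact imp_congr (ih1 ((le_max_left _ _).trans hφ) hc.1 h)
      (ih2 ((le_max_right _ _).trans hφ) hc.2 h)
  | all φ ih =>
    obtain ⟨m, rfl⟩ : ∃ k, m = k + 1 := ⟨m - 1, by simp only [Formula.depth] at hφ; omega⟩
    have hφ' : φ.depth ≤ m := Nat.le_of_succ_le_succ hφ
    constructor
    · intro H y
      obtain ⟨x, hx⟩ := h.2.2 y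
      exact (ih hφ' hc (by rwa [pairs_snoc])).1 (H x)
    · intro H x
      obtain ⟨y, hy⟩ := h.2.1 x
      exact (ih hφ' hc (by rwa [pairs_snoc])).2 (H y)

theorem realize_allNbr (z : Fin n) (φ : Formula (n + 1)) (a : Fin n → T.tree) :
    (Formula.allNbr z φ).Realize T a ↔
      ∀ x, T.Adj x (a z) → φ.Realize T (Fin.snoc (α := fun _ => T.tree) a x) := by
  simp [Formula.allNbr, Formula.adj, Formula.disj, Formula.neg, Formula.Realize, Term.eval, Adj,
    or_iff_not_imp_left]

theorem LocalEquiv.realize_iff {φ : Formula n} (hl : φ.IsLocal) (hφ : φ.depth ≤ m)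
    (hc : φ.ConstsBelow d) {a : Fin n → T.tree} {b : Fin n → T'.tree}
    (h : LocalEquiv d m (pairs a b)) : φ.Realize T a ↔ φ.Realize T' b := by
  induction hl generalizing m with
  | falsum => exact Iff.rfl
  | eq s t => exact (h.isPartialIso.realize_atom_iff hc.1 hc.2).1
  | parnt s t => exact (h.isPartialIso.realize_atom_iff hc.1 hc.2).2.1
  | succ s t => exact (h.isPartialIso.realize_atom_iff hc.1 hc.2).2.2
  | imp _ _ ih1 ih2 =>
    exact imp_congr (ih1 ((le_max_left _ _).trans hφ) hc.1 h)
      (ih2 ((le_max_right _ _).trans hφ) hc.2 h)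
  | @allNbr n z φ _ ih =>
    obtain ⟨m, rfl⟩ : ∃ k, m = k + 1 :=
      ⟨m - 1, by simp only [Formula.allNbr, Formula.depth] at hφ; omega⟩
    have hφ' : φ.depth ≤ m := (le_max_right _ _).trans (Nat.le_of_succ_le_succ hφ)
    have hc' : φ.ConstsBelow d := hc.2
    rw [realize_allNbr, realize_allNbr]
    constructor
    · intro H y hy
      obtain ⟨x, hx, hxy⟩ := (h.2 (a z, b z) ⟨z, rfl⟩).2 y hy
      exact (ih hφ' hc' (by rwa [pairs_snoc])).1 (H x hx)
    · intro H x hx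
      obtain ⟨y, hy, hxy⟩ := (h.2 (a z, b z) ⟨z, rfl⟩).1 x hx
      exact (ih hφ' hc' (by rwa [pairs_snoc])).2 (H y hy)

/-- The local formulas with `n` free variables, quantifier depth at most `m` and no constants
except for the first `d` ones. -/
def localFormulas (d m n : ℕ) : Set (Formula n) :=
  {φ | φ.IsLocal ∧ φ.depth ≤ m ∧ φ.ConstsBelow d}

namespace Formula

/-- Conjunction. -/
def conj (φ ψ : Formula n) : Formula n := neg (imp φ (neg ψ))

open Classical in
/-- The conjunction that says which formulas of the list `H` hold: exactly those in `S`. -/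
noncomputable def diagram (S : Set (Formula n)) : List (Formula n) → Formula n
  | [] => neg falsum
  | φ :: H => conj (if φ ∈ S then φ else neg φ) (diagram S H)

/-- The quantifier `∃_z x` over all neighbors `x` of the vertex `z`. -/
def exNbr (z : Fin n) (φ : Formula (n + 1)) : Formula n := neg (allNbr z (neg φ))

theorem realize_neg {φ : Formula n} {a : Fin n → T.tree} :
    (neg φ).Realize T a ↔ ¬ φ.Realize T a := Iff.rfl

theorem realize_conj {φ ψ : Formula n} {a : Fin n → T.tree} :
    (conj φ ψ).Realize T a ↔ φ.Realize T a ∧ ψ.Realize T a := by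
  simp [conj, neg, Realize]

theorem realize_exNbr {z : Fin n} {φ : Formula (n + 1)} {a : Fin n → T.tree} :
    (exNbr z φ).Realize T a ↔
      ∃ x, T.Adj x (a z) ∧ φ.Realize T (Fin.snoc (α := fun _ => T.tree) a x) := by
  simp [exNbr, realize_neg, realize_allNbr]

theorem realize_diagram {S : Set (Formula n)} {H : List (Formula n)} {a : Fin n → T.tree} :
    (diagram S H).Realize T a ↔ ∀ φ ∈ H, (φ.Realize T a ↔ φ ∈ S) := by
  induction H with
  | nil => simp [diagram, realize_neg, Realize]
  | cons φ H ih =>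
    rw [diagram, realize_conj, ih, List.forall_mem_cons]
    split_ifs with h <;> simp [h, realize_neg]

theorem neg_mem_localFormulas {φ : Formula n} (h : φ ∈ localFormulas d m n) :
    neg φ ∈ localFormulas d m n :=
  ⟨.imp h.1 .falsum, max_le h.2.1 (Nat.zero_le _), h.2.2, trivial⟩

theorem conj_mem_localFormulas {φ ψ : Formula n} (h : φ ∈ localFormulas d m n)
    (h' : ψ ∈ localFormulas d m n) : conj φ ψ ∈ localFormulas d m n := by
  have := neg_mem_localFormulas h'
  exact neg_mem_localFormulas ⟨.imp h.1 this.1, max_le h.2.1 this.2.1, h.2.2, this.2.2⟩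

theorem diagram_mem_localFormulas {S : Set (Formula n)} {H : List (Formula n)}
    (h : ∀ φ ∈ H, φ ∈ localFormulas d m n) : diagram S H ∈ localFormulas d m n := by
  induction H with
  | nil => exact neg_mem_localFormulas ⟨.falsum, Nat.zero_le _, trivial⟩
  | cons φ H ih =>
    rw [List.forall_mem_cons] at h
    refine conj_mem_localFormulas ?_ (ih h.2)
    split_ifs
    · exact h.1
    · exact neg_mem_localFormulas h.1

theorem exNbr_mem_localFormulas {z : Fin n} {φ : Formula (n + 1)}
    (h : φ ∈ localFormulas d m (n + 1)) : exNbr z φ ∈ localFormulas d (m + 1) n := by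
  have := neg_mem_localFormulas h
  refine neg_mem_localFormulas ⟨.allNbr z this.1, ?_, ?_, this.2.2⟩
  · exact Nat.succ_le_succ (max_le (by simp [adj, disj, neg, depth]) this.2.1)
  · simp [adj, disj, neg, ConstsBelow, Term.ConstsBelow]

theorem finite_range_diagram (H : List (Formula n)) :
    (Set.range fun S => diagram S H).Finite := by
  induction H with
  | nil => exact (Set.finite_singleton (neg falsum)).subset (by rintro _ ⟨S, rfl⟩; rfl)
  | cons φ H ih =>
    refine (Set.Finite.image2 conj (Set.toFinite {φ, neg φ}) ih).subset ?_
    rintro _ ⟨S, rfl⟩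
    refine ⟨_, ?_, _, ⟨S, rfl⟩, rfl⟩
    split_ifs <;> simp

end Formula

theorem finite_constsBelow (d n : ℕ) : {s : Term n | s.ConstsBelow d}.Finite := by
  refine ((Set.finite_range Term.var).union ((Set.finite_Iio d).image Term.const)).subset ?_
  rintro (i | i) hi
  · exact .inl ⟨i, rfl⟩
  · exact .inr ⟨i, hi, rfl⟩

/-- The atomic formulas with `n` free variables and no constants except for the first `d` ones. -/
def atoms (d n : ℕ) : Set (Formula n) :=
  Set.image2 Formula.eq {s | s.ConstsBelow d} {s | s.ConstsBelow d} ∪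
    (Set.image2 Formula.parnt {s | s.ConstsBelow d} {s | s.ConstsBelow d} ∪
      Set.image2 Formula.succ {s | s.ConstsBelow d} {s | s.ConstsBelow d})

theorem finite_atoms (d n : ℕ) : (atoms d n).Finite :=
  have h := finite_constsBelow d n
  (h.image2 _ h).union ((h.image2 _ h).union (h.image2 _ h))

theorem atoms_subset_localFormulas (d m n : ℕ) : atoms d n ⊆ localFormulas d m n := by
  rintro _ (⟨s, hs, t, ht, rfl⟩ | ⟨s, hs, t, ht, rfl⟩ | ⟨s, hs, t, ht, rfl⟩)
  · exact ⟨.eq s t, Nat.zero_le _, hs, ht⟩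
  · exact ⟨.parnt s t, Nat.zero_le _, hs, ht⟩
  · exact ⟨.succ s t, Nat.zero_le _, hs, ht⟩

theorem isPartialIso_of_atoms {a : Fin n → T.tree} {b : Fin n → T'.tree}
    (h : ∀ φ ∈ atoms d n, (φ.Realize T a ↔ φ.Realize T' b)) : IsPartialIso d (pairs a b) := by
  refine ⟨fun i hi => ?_, fun p hp q hq => ?_⟩
  · have := h (.eq (.const i) (.const i)) (.inl ⟨_, hi, _, hi, rfl⟩)
    simpa [Formula.Realize, Term.eval, Option.isSome_iff_exists] using this
  · obtain ⟨s, hs, h1, h2⟩ := mem_pairs_union_constPairs.1 hp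
    obtain ⟨t, ht, h3, h4⟩ := mem_pairs_union_constPairs.1 hq
    have e1 := h (.eq s t) (.inl ⟨s, hs, t, ht, rfl⟩)
    have e2 := h (.parnt s t) (.inr (.inl ⟨s, hs, t, ht, rfl⟩))
    have e3 := h (.succ s t) (.inr (.inr ⟨s, hs, t, ht, rfl⟩))
    simp only [Formula.Realize, h1, h2, h3, h4, Option.some.injEq] at e1 e2 e3
    exact ⟨by simpa [eq_comm] using e1, by simpa using e2, by simpa using e3⟩

/-- Finitely many local formulas of quantifier depth at most `m` suffice to decide whether
Duplicator wins the local game with `m` rounds. -/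
theorem exists_finite_localEquiv_of_realize_iff (d m n : ℕ) :
    ∃ H : Set (Formula n), H.Finite ∧ H ⊆ localFormulas d m n ∧
      ∀ (T : PlaneCTree.{u}) (T' : PlaneCTree.{v}) (a : Fin n → T.tree) (b : Fin n → T'.tree),
        (∀ φ ∈ H, (φ.Realize T a ↔ φ.Realize T' b)) → LocalEquiv d m (pairs a b) := by
  induction m generalizing n with
  | zero =>
    exact ⟨atoms d n, finite_atoms d n, atoms_subset_localFormulas d 0 n,
      fun T T' a b h => isPartialIso_of_atoms h⟩
  | succ m ih =>
    obtain ⟨H, hfin, hH, hgame⟩ := ih (n + 1)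
    obtain ⟨L, hL⟩ : ∃ L : List (Formula (n + 1)), ∀ φ, φ ∈ L ↔ φ ∈ H :=
      ⟨hfin.toFinset.toList, by simp⟩
    refine ⟨atoms d n ∪ Set.image2 Formula.exNbr Set.univ (Set.range fun S => Formula.diagram S L),
      (finite_atoms d n).union (Set.finite_univ.image2 _ (Formula.finite_range_diagram L)), ?_, ?_⟩
    · refine Set.union_subset (atoms_subset_localFormulas d _ n) ?_
      rintro _ ⟨z, -, _, ⟨S, rfl⟩, rfl⟩
      exact Formula.exNbr_mem_localFormulas
        (Formula.diagram_mem_localFormulas fun φ hφ => hH ((hL φ).1 hφ))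
    · intro T T' a b h
      refine ⟨isPartialIso_of_atoms fun φ hφ => h φ (.inl hφ), ?_⟩
      rintro _ ⟨z, rfl⟩
      have hex : ∀ S, (Formula.exNbr z (Formula.diagram S L)).Realize T a ↔
          (Formula.exNbr z (Formula.diagram S L)).Realize T' b :=
        fun S => h _ (.inr ⟨z, trivial, _, ⟨S, rfl⟩, rfl⟩)
      refine ⟨fun x hx => ?_, fun y hy => ?_⟩
      · obtain ⟨y, hy, hxy⟩ := Formula.realize_exNbr.1
          ((hex {φ | φ.Realize T (Fin.snoc (α := fun _ => T.tree) a x)}).1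
            (Formula.realize_exNbr.2 ⟨x, hx, Formula.realize_diagram.2 fun φ _ => Iff.rfl⟩))
        refine ⟨y, hy, ?_⟩
        rw [← pairs_snoc]
        exact hgame _ _ _ _ fun φ hφ =>
          (Formula.realize_diagram.1 hxy φ ((hL φ).2 hφ)).symm
      · obtain ⟨x, hx, hxy⟩ := Formula.realize_exNbr.1
          ((hex {φ | φ.Realize T' (Fin.snoc (α := fun _ => T'.tree) b y)}).2
            (Formula.realize_exNbr.2 ⟨y, hy, Formula.realize_diagram.2 fun φ _ => Iff.rfl⟩))
        refine ⟨x, hx, ?_⟩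
        rw [← pairs_snoc]
        exact hgame _ _ _ _ fun φ hφ => Formula.realize_diagram.1 hxy φ ((hL φ).2 hφ)

end Formulas

/-! ### Counting nodes of a local type -/

section Types

variable {T : PlaneCTree.{u}} {T' : PlaneCTree.{v}} {d m : ℕ}

/-- The variant of the Hintikka type of a node with separate bounds `d` on the constants and `m`
on the quantifier depth. -/
def localType (T : PlaneCTree.{u}) (d m : ℕ) (x : T.tree) : Set (Formula 1) :=
  {φ | φ ∈ localFormulas d m 1 ∧ φ.Realize T (fun _ => x)}

theorem pairs_const (x : T.tree) (y : T'.tree) :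
    pairs (fun _ : Fin 1 => x) (fun _ => y) = {(x, y)} :=
  Set.range_const

theorem localType_eq_iff {x : T.tree} {y : T'.tree} :
    T.localType d m x = T'.localType d m y ↔ LocalEquiv d m {(x, y)} := by
  rw [← pairs_const]
  constructor
  · intro h
    obtain ⟨H, -, hH, hgame⟩ := exists_finite_localEquiv_of_realize_iff.{u, v} d m 1
    refine hgame T T' _ _ fun φ hφ => ?_
    have := Set.ext_iff.1 h φ
    simpa [localType, hH hφ] using this
  · intro h
    ext φ
    exact and_congr_right fun hφ => h.realize_iff hφ.1 hφ.2.1 hφ.2.2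

theorem Formula.ConstsBelow.mono {D n : ℕ} {φ : Formula n} (h : φ.ConstsBelow d) (hd : d ≤ D) :
    φ.ConstsBelow D := by
  have term : ∀ {n : ℕ} {s : Term n}, s.ConstsBelow d → s.ConstsBelow D := by
    rintro n (i | i) hs
    · trivial
    · exact lt_of_lt_of_le hs hd
  induction φ with
  | falsum => trivial
  | eq s t => exact h.imp term term
  | parnt s t => exact h.imp term term
  | succ s t => exact h.imp term term
  | imp φ ψ ih1 ih2 => exact h.imp ih1 ih2
  | all φ ih => exact ih h

theorem localType_eq_hintikkaType_inter {D : ℕ} (hd : d ≤ D) (hm : m ≤ D) (x : T.tree) :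
    T.localType d m x = T.hintikkaType D x ∩ localFormulas d m 1 := by
  ext φ
  constructor
  · rintro ⟨h, hx⟩
    exact ⟨⟨h.1, ⟨h.2.1.trans hm, h.2.2.mono hd⟩, hx⟩, h⟩
  · rintro ⟨h, h'⟩
    exact ⟨h', h.2.2⟩

/-- The numbers of nodes of each `D`-Hintikka type in `T` and in `T'` are the same, unless there
are at least `Γ` of them in both trees. -/
def CountsAgree (T : PlaneCTree.{u}) (T' : PlaneCTree.{v}) (D Γ : ℕ) : Prop :=
  ∀ τ : Set (Formula 1), T.typeCount D τ = T'.typeCount D τ ∨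
    ((Γ : ℕ∞) ≤ T.typeCount D τ ∧ (Γ : ℕ∞) ≤ T'.typeCount D τ)

theorem CountsAgree.symm {D Γ : ℕ} (h : CountsAgree T T' D Γ) : CountsAgree T' T D Γ :=
  fun τ => (h τ).imp Eq.symm And.symm

/-- The comparison of the numbers of nodes passes from Hintikka types to sets of Hintikka types:
the types in `Θ` occur less than `Γ` times in `T'`, so that each of them occurs equally often in
`T`. This is what allows types of smaller depth to be counted. -/
theorem CountsAgree.encard_le {D Γ : ℕ} (h : CountsAgree T T' D Γ) (Θ : Set (Set (Formula 1)))
    (hΘ : {y | T'.hintikkaType D y ∈ Θ}.encard < Γ) :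
    {x | T.hintikkaType D x ∈ Θ}.encard ≤ {y | T'.hintikkaType D y ∈ Θ}.encard := by
  have key : ∀ τ ∈ Θ, ∃ f : T.tree → T'.tree,
      {x | T.hintikkaType D x = τ} ⊆ f ⁻¹' {y | T'.hintikkaType D y = τ} ∧
        Set.InjOn f {x | T.hintikkaType D x = τ} := by
    intro τ hτ
    have hlt : T'.typeCount D τ < Γ :=
      (Set.encard_le_encard fun y (hy : T'.hintikkaType D y = τ) =>
        show T'.hintikkaType D y ∈ Θ from hy ▸ hτ).trans_lt hΘ
    have heq : T.typeCount D τ = T'.typeCount D τ :=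
      (h τ).resolve_right fun h' => (h'.2.trans_lt hlt).false
    have hfin : {x | T.hintikkaType D x = τ}.Finite :=
      Set.encard_lt_top_iff.1 (heq.trans_lt (hlt.trans (ENat.natCast_lt_top Γ)))
    have : Nonempty T'.tree := ⟨⊥⟩
    exact hfin.exists_injOn_of_encard_le heq.le
  choose! f hf hinj using key
  refine Set.encard_le_encard_of_injOn (f := fun x => f (T.hintikkaType D x) x) ?_ ?_
  · intro x hx
    have : T'.hintikkaType D (f (T.hintikkaType D x) x) = T.hintikkaType D x := hf _ hx rfl
    exact show T'.hintikkaType D _ ∈ Θ from this.symm ▸ hx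
  · intro x hx x' hx' hxx'
    have h1 : T'.hintikkaType D (f (T.hintikkaType D x) x) = T.hintikkaType D x := hf _ hx rfl
    have h2 : T'.hintikkaType D (f (T.hintikkaType D x') x') = T.hintikkaType D x' := hf _ hx' rfl
    have h3 : T.hintikkaType D x' = T.hintikkaType D x := by
      rw [← h1, ← h2]
      exact congrArg _ hxx'.symm
    refine hinj _ hx rfl h3 ?_
    simpa [h3] using hxx'

theorem CountsAgree.encard_localType_le {D Γ : ℕ} (h : CountsAgree T T' D Γ) (hd : d ≤ D)
    (hm : m ≤ D) (τ : Set (Formula 1)) (hτ : {y | T'.localType d m y = τ}.encard < Γ) :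
    {x | T.localType d m x = τ}.encard ≤ {y | T'.localType d m y = τ}.encard := by
  simp only [localType_eq_hintikkaType_inter hd hm] at hτ ⊢
  exact h.encard_le {σ | σ ∩ localFormulas d m 1 = τ} hτ

/-- A node `x` far from the nodes of the position has a counterpart `y` of the same local type that
is far, too. Otherwise every node with the type of the ancestor `w` of `x` that lies `m + 1` levels
above it would be an ancestor of a node of the position in `T'`. There are few such nodes, so that
there are as many nodes with the type of `w` in `T`. But the position already yields that many of
them among the ancestors of its nodes in `T`, and `w` is none of these. -/
theorem exists_far_localEquiv {D Γ : ℕ} (hcount : CountsAgree T T' D Γ) (hd : d ≤ D)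
    (hm : 2 * m + 1 ≤ D) {P : Set (T.tree × T'.tree)}
    (hΓ : P.encard * ((2 * (m + 1) + 1 : ℕ) : ℕ∞) < Γ) (hP : LocalEquiv d (5 * m + 4) P)
    {x : T.tree} (hx : ∀ p ∈ P, ¬ T.Near (2 * (m + 1)) p.1 x) :
    ∃ y, LocalEquiv d m {(x, y)} ∧ ∀ p ∈ P, ¬ T'.Near (m + 1) p.2 y := by
  by_contra! hcon
  set w := pred^[m + 1] x with hw
  set S := {v | T.localType d (2 * m + 1) v = T.localType d (2 * m + 1) w}
  set S' := {v | T'.localType d (2 * m + 1) v = T.localType d (2 * m + 1) w}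
  -- every node of `S'` is an ancestor of a node of the position
  have hanc : ∀ v ∈ S', ∃ p ∈ P, ∃ l ≤ 2 * (m + 1), pred^[l] p.2 = v := by
    intro v hv
    have hwv : LocalEquiv d (m + (m + 1)) {(w, v)} :=
      (show 2 * m + 1 = m + (m + 1) by omega) ▸ localType_eq_iff.1 hv.symm
    obtain ⟨y, hy, hxy⟩ := hwv.exists_iterate_pred_eq (x := x) rfl
    obtain ⟨p, hp, hnear⟩ := hcon y (hxy.mono (by simp))
    obtain ⟨l, hl, h⟩ := hnear.symm.exists_iterate_pred_eq
    exact ⟨p, hp, l, hl, by rw [← h, hy]⟩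
  have hcard : S'.encard < Γ := by
    refine lt_of_le_of_lt ?_ hΓ
    have hsub : S' ⊆ (fun q : (T.tree × T'.tree) × ℕ => pred^[q.2] q.1.2) ''
        (P ×ˢ Set.Iio (2 * (m + 1) + 1)) := by
      intro v hv
      obtain ⟨p, hp, l, hl, h⟩ := hanc v hv
      exact ⟨(p, l), ⟨hp, Nat.lt_succ_of_le hl⟩, h⟩
    refine (Set.encard_le_encard hsub).trans ((Set.encard_image_le _ _).trans ?_)
    rw [Set.encard_prod]
    gcongr
    rw [← Finset.coe_Iio, Set.encard_coe_eq_coe_finsetCard, Nat.card_Iio]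
  have hle : S.encard ≤ S'.encard := hcount.encard_localType_le hd hm _ hcard
  -- the same ancestors of the nodes of the position in `T` have the same type
  choose! p hp l hl hpl using hanc
  have hinj : S'.encard ≤ (S \ {w}).encard := by
    refine Set.encard_le_encard_of_injOn (f := fun v => pred^[l v] (p v).1) ?_ ?_
    · intro v hv
      refine ⟨?_, fun (heq : _ = _) => ?_⟩
      · have h1 : LocalEquiv d (2 * m + 1 + l v) P := hP.of_le (by have := hl v hv; omega)
        have h2 := localType_eq_iff.2 ((h1.insert_iterate_pred (hp v hv)).mono
          (Set.singleton_subset_iff.2 (Set.mem_insert _ _)))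
        rw [hpl v hv] at h2
        exact h2.trans hv
      · exact hx _ (hp v hv) ⟨l v, hl v hv, m + 1, by omega, heq⟩
    · intro v hv v' hv' heq
      have h1 : LocalEquiv d (0 + l v' + l v) P :=
        hP.of_le (by have := hl v hv; have := hl v' hv'; omega)
      have h2 := ((h1.insert_iterate_pred (hp v hv)).insert_iterate_pred
        (Set.mem_insert_of_mem _ (hp v' hv')))
      have h3 := (h2.isPartialIso.2 (_, _) (.inl (.inr (.inl rfl))) (_, _)
        (.inl (.inl rfl))).1.1 heq
      simpa only [hpl v hv, hpl v' hv'] using h3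
  have hfin : S.Finite := Set.encard_lt_top_iff.1 ((hle.trans_lt hcard).trans (ENat.natCast_lt_top Γ))
  have hlt : (S \ {w}).encard < S.encard :=
    (hfin.subset Set.sdiff_subset).encard_lt_encard
      ⟨Set.sdiff_subset, fun h => (h (show w ∈ S from rfl)).2 rfl⟩
  exact (hinj.trans_lt (hlt.trans_le hle)).false

/-- A move of Spoiler can be answered so that Duplicator still wins a shorter local game. -/
theorem exists_localEquiv_insert {D Γ : ℕ} (hcount : CountsAgree T T' D Γ) (hd : d ≤ D)
    (hm : 2 * m + 1 ≤ D) {P : Set (T.tree × T'.tree)}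
    (hΓ : P.encard * ((2 * (m + 1) + 1 : ℕ) : ℕ∞) < Γ) (hP : LocalEquiv d (5 * m + 4) P)
    (x : T.tree) : ∃ y, LocalEquiv d m (insert (x, y) P) := by
  by_cases hx : ∃ p ∈ P, T.Near (2 * (m + 1)) p.1 x
  · obtain ⟨p, hp, k, hk, l, hl, h⟩ := hx
    have h1 : LocalEquiv d (m + l + k) P := hP.of_le (by omega)
    have h2 := h1.insert_iterate_pred (a := p.1) (b := p.2) hp
    obtain ⟨y, -, hy⟩ := h2.exists_iterate_pred_eq (x := x) (.inl (by rw [h]))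
    exact ⟨y, hy.mono (Set.insert_subset_insert (Set.subset_insert _ _))⟩
  · push Not at hx
    obtain ⟨y, hxy, hy⟩ := exists_far_localEquiv hcount hd hm hΓ hP hx
    refine ⟨y, ?_⟩
    rw [Set.insert_eq]
    refine hxy.union (hP.of_le (by omega)) ?_
    rintro _ rfl p hp
    exact ⟨fun e => hx p hp (e.symm.mono (by omega)), fun e => hy p hp e.symm⟩

/-- Winning `5 ^ j - 1` local rounds suffices for winning `j` global ones, since
`exists_localEquiv_insert` needs `5 * m + 4` local rounds to leave `m` of them. The bound `Γ`
exceeds the number of pairs of a chosen node and the index of one of its first ancestors. -/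
theorem globalEquiv_of_localEquiv {k j D Γ : ℕ} (hcount : CountsAgree T T' D Γ) (hd : d ≤ D)
    (hD : 5 ^ (k + j) ≤ D) (hΓ : (k + j) * (2 * 5 ^ (k + j) + 1) < Γ)
    {P : Set (T.tree × T'.tree)} (hk : P.encard ≤ k) (hP : LocalEquiv d (5 ^ j - 1) P) :
    GlobalEquiv d j P := by
  induction j generalizing k P with
  | zero => exact hP
  | succ j ih =>
    have hpos : 0 < 5 ^ j := by positivity
    have hpow : 5 ^ (j + 1) ≤ 5 ^ (k + (j + 1)) := Nat.pow_le_pow_right (by norm_num) (by omega)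
    rw [pow_succ] at hpow
    have hm : 2 * (5 ^ j - 1) + 1 ≤ D := by omega
    have hP' : LocalEquiv d (5 * (5 ^ j - 1) + 4) P := hP.of_le (by rw [pow_succ]; omega)
    have hcard : P.encard * ((2 * (5 ^ j - 1 + 1) + 1 : ℕ) : ℕ∞) < Γ := by
      have h1 : k * (2 * (5 ^ j - 1 + 1) + 1) < Γ :=
        lt_of_le_of_lt (Nat.mul_le_mul (by omega) (by omega)) hΓ
      calc P.encard * ((2 * (5 ^ j - 1 + 1) + 1 : ℕ) : ℕ∞)
          ≤ (k : ℕ∞) * ((2 * (5 ^ j - 1 + 1) + 1 : ℕ) : ℕ∞) := by gcongr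
        _ < Γ := by exact_mod_cast h1
    have next : ∀ x y, LocalEquiv d (5 ^ j - 1) (insert (x, y) P) →
        GlobalEquiv d j (insert (x, y) P) := by
      intro x y hxy
      rw [show k + (j + 1) = k + 1 + j by omega] at hD
      refine ih (k := k + 1) hD ?_ ?_ hxy
      · rwa [show k + 1 + j = k + (j + 1) by omega]
      · exact (Set.encard_insert_le _ _).trans (by push_cast; gcongr)
    refine ⟨hP.isPartialIso, fun x => ?_, fun y => ?_⟩
    · obtain ⟨y, hxy⟩ := exists_localEquiv_insert hcount hd hm hcard hP' x
      exact ⟨y, next x y hxy⟩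
    · have hswap : (Prod.swap ⁻¹' P : Set (T'.tree × T.tree)).encard = P.encard := by
        rw [← Set.image_swap_eq_preimage_swap, Prod.swap_injective.encard_image]
      obtain ⟨x, hxy⟩ := exists_localEquiv_insert hcount.symm hd hm (hswap ▸ hcard) hP'.swap y
      refine ⟨x, next x y (hxy.swap.mono ?_)⟩
      rintro p (rfl | hp)
      · exact .inl rfl
      · exact .inr hp

end Types

end PlaneCTree

open PlaneCTree in
theorem theorem3p6 (d : ℕ) :
    ∃ D Γ : ℕ, ∀ (T : PlaneCTree.{u}) (T' : PlaneCTree.{v}),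
      (∀ τ : Set (PlaneCTree.Formula 1),
        T.typeCount D τ = T'.typeCount D τ ∨
          ((Γ : ℕ∞) ≤ T.typeCount D τ ∧ (Γ : ℕ∞) ≤ T'.typeCount D τ)) →
      T.dTheory d = T'.dTheory d := by
  refine ⟨5 ^ d, d * (2 * 5 ^ d + 1) + 1, fun T T' h => ?_⟩
  have hcount : CountsAgree T T' (5 ^ d) (d * (2 * 5 ^ d + 1) + 1) := h
  have hd : d ≤ 5 ^ d := (Nat.lt_pow_self (by norm_num)).le
  -- some node of `T'` has the type of the root of `T`
  have hroot : LocalEquiv d (5 ^ d - 1) (∅ : Set (T.tree × T'.tree)) := by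
    have hne : ∃ y, T'.localType d (5 ^ d - 1) y = T.localType d (5 ^ d - 1) ⊥ := by
      by_contra! hne
      have hempty : {y | T'.localType d (5 ^ d - 1) y = T.localType d (5 ^ d - 1) ⊥} = ∅ :=
        Set.eq_empty_of_forall_notMem hne
      have := hcount.encard_localType_le hd (Nat.sub_le _ _)
        (T.localType d (5 ^ d - 1) ⊥) (by rw [hempty]; simp)
      rw [hempty, Set.encard_empty, nonpos_iff_eq_zero, Set.encard_eq_zero] at this
      exact (this ▸ show (⊥ : T.tree) ∈ {x | T.localType d (5 ^ d - 1) x =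
        T.localType d (5 ^ d - 1) ⊥} from rfl : (⊥ : T.tree) ∈ (∅ : Set T.tree))
    obtain ⟨y, hy⟩ := hne
    exact (localType_eq_iff.1 hy.symm).mono (Set.empty_subset _)
  have hglobal : GlobalEquiv d d (∅ : Set (T.tree × T'.tree)) :=
    globalEquiv_of_localEquiv (k := 0) hcount hd (by simp) (by simp) (by simp) hroot
  ext φ
  refine and_congr_right fun hφ => GlobalEquiv.realize_iff hφ.1 hφ.2 (m := d) ?_
  rwa [pairs, Set.range_eq_empty]
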